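/- Let $(\Omega,\Sigma)$ be a measurable space. Let $B(\Omega,\Sigma)$ be the space of bounded measurable functions $\Omega\to\mathbb{R}$, $ba(\Omega,\Sigma)$ the space of bounded finitely additive signed measures on $(\Omega,\Sigma)$, $\mathcal{P}(\Omega,\Sigma)\subseteq ba(\Omega,\Sigma)$ the set of finitely additive probability measures and $\mathcal{P}_c(\Omega,\Sigma)\subseteq\mathcal{P}(\Omega,\Sigma)$ the set of countably additive ones. For $\mu\in ba(\Omega,\Sigma)$ and $Q\in\mathcal{P}_c(\Omega,\Sigma)$ write $\mu\ll Q$ if $Q(E)=0$ implies $\mu(E)=0$ for every $E\in\Sigma$; write $\mathbb{E}_\mu[h]=\int_\Omega h\,d\mu$. Let $f:\mathbb{R}\to(-\infty,\infty]$ be lower semicontinuous and convex, with $f(1)=0$, $f$ finite in a neighbourhood of $1$, and $f(x)=\infty$ for all $x<0$; let $f^*(s)=\sup_{x\in\mathbb{R}}\,xs-f(x)$. For $P\in\mathcal{P}(\Omega,\Sigma)$ and $Q\in\mathcal{P}_c(\Omega,\Sigma)$ let $$\bar D_f(P\|Q)=\begin{cases}\displaystyle\int_\Omega f\!\left(\frac{dP}{dQ}\right)dQ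 & \text{if } P\in\mathcal{P}_c(\Omega,\Sigma)\text{ and }P\ll Q,\\[2mm] \displaystyle\sup_{h\in B(\Omega,\Sigma)}\mathbb{E}_P[h]-\mathbb{E}_Q[f^*(h)] & \text{otherwise.}\end{cases}$$ For a functional $\lambda:B(\Omega,\Sigma)\to[-\infty,\infty]$ let $$D_{f,\lambda}(P\|Q)=\sup_{h\in B(\Omega,\Sigma)}\mathbb{E}_P[h]-\mathbb{E}_Q[f^*(h)]-\lambda(h),\qquad \lambda^*(\mu)=\sup_{h\in B(\Omega,\Sigma)}\int_\Omega h\,d\mu-\lambda(h)\quad(\mu\in ba(\Omega,\Sigma)),$$ where $\infty-\infty$ is read as $-\infty$. Theorem. Suppose that $\lambda:B(\Omega,\Sigma)\to[-\infty,\infty]$ is convex (its epigraph is a convex set) and shift invariant, that is, $\lambda(h+b)=\lambda(h)$ for all $h\in B(\Omega,\Sigma)$ and $b\in\mathbb{R}$. Then for all $P\in\mathcal{P}(\Omega,\Sigma)$ and $Q\in\mathcal{P}_c(\Omega,\Sigma)$, $$D_{f,\lambda}(P\|Q)=\inf_{P'\in\mathcal{P}(\Omega,\Sigma)}\lambda^*(P-P')+\bar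 D_f(P'\|Q)=\inf_{\substack{P'\in\mathcal{P}(\Omega,\Sigma)\\ P'\ll Q}}\lambda^*(P-P')+\bar D_f(P'\|Q).$$ -/

import Mathlib

open Filter Topology MeasureTheory
open scoped ENNReal

noncomputable section

namespace FDiv

/-! ### Bounded measurable functions and finitely additive measures -/

/-- `B(Ω, Σ)`: the real vector space of bounded measurable functions `Ω → ℝ`. -/
def B (Ω : Type*) [MeasurableSpace Ω] : Submodule ℝ (Ω → ℝ) where
  carrier := {h | Measurable h ∧ ∃ C : ℝ, ∀ ω, |h ω| ≤ C}
  add_mem' := by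
    rintro g h ⟨hg, C, hC⟩ ⟨hh, D, hD⟩
    exact ⟨hg.add hh, C + D, fun ω => (abs_add_le _ _).trans (add_le_add (hC ω) (hD ω))⟩
  zero_mem' := ⟨measurable_const, 0, fun ω => by simp⟩
  smul_mem' := by
    rintro c h ⟨hh, C, hC⟩
    refine ⟨hh.const_smul c, |c| * C, fun ω => ?_⟩
    simpa [abs_mul] using mul_le_mul_of_nonneg_left (hC ω) (abs_nonneg c)

/-- The constant function `b`, as an element of `B(Ω, Σ)`. -/
def B.const (Ω : Type*) [MeasurableSpace Ω] (b : ℝ) : B Ω :=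
  ⟨fun _ => b, measurable_const, |b|, fun _ => le_rfl⟩

/-- `ba(Ω, Σ)`: the real vector space of bounded, finitely additive signed measures on `Ω`.
As for Mathlib's `VectorMeasure`, the value is `0` on sets outside the σ-algebra. -/
def ba (Ω : Type*) [MeasurableSpace Ω] : Submodule ℝ (Set Ω → ℝ) where
  carrier := {μ | (∀ E, ¬ MeasurableSet E → μ E = 0) ∧
    (∀ E F, MeasurableSet E → MeasurableSet F → Disjoint E F → μ (E ∪ F) = μ E + μ F) ∧
    ∃ C : ℝ, ∀ E, |μ E| ≤ C}
  add_mem' := by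
    rintro μ ν ⟨h1, h2, C, h3⟩ ⟨k1, k2, D, k3⟩
    refine ⟨fun E hE => by simp [h1 E hE, k1 E hE], fun E F hE hF hEF => ?_, C + D,
      fun E => (abs_add_le _ _).trans (add_le_add (h3 E) (k3 E))⟩
    simp only [Pi.add_apply, h2 E F hE hF hEF, k2 E F hE hF hEF]
    ring
  zero_mem' := ⟨fun _ _ => rfl, fun _ _ _ _ _ => by simp, 0, fun _ => by simp⟩
  smul_mem' := by
    rintro c μ ⟨h1, h2, C, h3⟩
    refine ⟨fun E hE => by simp [h1 E hE], fun E F hE hF hEF => ?_, |c| * C, fun E => ?_⟩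
    · simp only [Pi.smul_apply, smul_eq_mul, h2 E F hE hF hEF]
      ring
    · simpa [abs_mul] using mul_le_mul_of_nonneg_left (h3 E) (abs_nonneg c)

/-- `𝒫(Ω, Σ)`: finitely additive probability measures. -/
def FinAddProb (Ω : Type*) [MeasurableSpace Ω] : Type _ :=
  {P : ba Ω // (∀ E, 0 ≤ P.1 E) ∧ P.1 Set.univ = 1}

variable {Ω : Type*} [MeasurableSpace Ω]

/-- `μ ≪ Q`: every measurable `Q`-null set is `μ`-null. -/
def AbsCont (μ : ba Ω) (Q : Measure Ω) : Prop :=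
  ∀ E, MeasurableSet E → Q E = 0 → μ.1 E = 0

/-- Countable additivity of an element of `ba(Ω, Σ)`. -/
def IsCountablyAdditive (μ : ba Ω) : Prop :=
  ∀ E : ℕ → Set Ω, (∀ i, MeasurableSet (E i)) → Pairwise (Function.onFun Disjoint E) →
    HasSum (fun i => μ.1 (E i)) (μ.1 (⋃ i, E i))

theorem ba_empty (μ : ba Ω) : μ.1 ∅ = 0 := by
  have h := μ.2.2.1 ∅ ∅ .empty .empty (by simp)
  simpa using h

/-- A countably additive element of `𝒫(Ω, Σ)`, as a measure in Mathlib's sense. -/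
def toMeasure (P : FinAddProb Ω) (hP : IsCountablyAdditive P.1) : Measure Ω :=
  Measure.ofMeasurable (fun E _ => ENNReal.ofReal (P.1.1 E)) (by simp [ba_empty]) (by
    intro E hE hd
    have h := hP E hE hd
    rw [← h.tsum_eq, ENNReal.ofReal_tsum_of_nonneg (fun i => P.2.1 _) h.summable])

/-! ### The integral of a bounded measurable function against an element of `ba(Ω, Σ)` -/

/-- The integral of a simple function: `∑ y · μ {s = y}` over the values `y` of `s`. -/
def simpleIntegral (μ : ba Ω) (s : SimpleFunc Ω ℝ) : ℝ :=
  ∑ y ∈ s.range, y * μ.1 (s ⁻¹' {y})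

/-- The filter of simple functions that tend to `h` uniformly. -/
def uniformNear (h : B Ω) : Filter (SimpleFunc Ω ℝ) :=
  ⨅ ε : {ε : ℝ // 0 < ε}, 𝓟 {s | ∀ ω, |s ω - h.1 ω| ≤ ε.1}

/-- `∫ h dμ`: the limit of the integrals of simple functions tending to `h` uniformly. -/
def integral (μ : ba Ω) (h : B Ω) : ℝ :=
  limUnder (uniformNear h) (simpleIntegral μ)

theorem hasBasis_uniformNear (h : B Ω) :
    (uniformNear h).HasBasis (fun ε : ℝ => 0 < ε) (fun ε => {s | ∀ ω, |s ω - h.1 ω| ≤ ε}) := by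
  have : Nonempty {ε : ℝ // 0 < ε} := ⟨⟨1, one_pos⟩⟩
  refine ⟨fun t => ?_⟩
  rw [uniformNear, mem_iInf_of_directed]
  · simp [mem_principal]
  · rintro ⟨a, ha⟩ ⟨b, hb⟩
    refine ⟨⟨min a b, lt_min ha hb⟩, ?_, ?_⟩ <;>
    · simp only [ge_iff_le, le_principal_iff, mem_principal]
      intro s hs ω
      have := hs ω
      simp_all

instance uniformNear_neBot (h : B Ω) : (uniformNear h).NeBot := by
  rw [(hasBasis_uniformNear h).neBot_iff]
  intro ε hε
  obtain ⟨hm, C, hC⟩ := h.2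
  have hg : Measurable (fun ω => ⌊h.1 ω / ε⌋) := Int.measurable_floor.comp (hm.div_const ε)
  refine ⟨⟨fun ω => ε * (⌊h.1 ω / ε⌋ : ℝ), fun x => ?_, ?_⟩, fun ω => ?_⟩
  · exact ((measurable_from_top (f := fun n : ℤ => ε * (n : ℝ))).comp hg)
      (measurableSet_singleton x)
  · refine ((Set.finite_Icc ⌊-C / ε⌋ ⌊C / ε⌋).image (fun n : ℤ => ε * (n : ℝ))).subset ?_
    rintro _ ⟨ω, rfl⟩
    refine ⟨⌊h.1 ω / ε⌋, ⟨Int.floor_le_floor ?_, Int.floor_le_floor ?_⟩, rfl⟩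
    · exact div_le_div_of_nonneg_right (abs_le.1 (hC ω)).1 hε.le
    · exact div_le_div_of_nonneg_right (abs_le.1 (hC ω)).2 hε.le
  · change |ε * (⌊h.1 ω / ε⌋ : ℝ) - h.1 ω| ≤ ε
    have h1 := Int.floor_le (h.1 ω / ε)
    have h2 := (Int.lt_floor_add_one (h.1 ω / ε)).le
    rw [le_div_iff₀ hε] at h1
    rw [div_le_iff₀ hε] at h2
    rw [abs_le]
    constructor <;> nlinarith

theorem ba_biUnion (μ : ba Ω) (s : SimpleFunc Ω ℝ) (I : Finset ℝ) :
    μ.1 (s ⁻¹' I) = ∑ y ∈ I, μ.1 (s ⁻¹' {y}) := by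
  classical
  induction I using Finset.induction_on with
  | empty => simpa using ba_empty μ
  | insert a I ha ih =>
    rw [Finset.sum_insert ha, ← ih, Finset.coe_insert, Set.insert_eq, Set.preimage_union]
    refine μ.2.2.1 _ _ (s.measurableSet_preimage _) (s.measurableSet_preimage _) ?_
    exact Disjoint.preimage _ (by simpa using ha)

theorem simpleIntegral_sub (μ : ba Ω) (s t : SimpleFunc Ω ℝ) :
    simpleIntegral μ (s - t) = simpleIntegral μ s - simpleIntegral μ t := by
  have key : ∀ u : SimpleFunc Ω ℝ, simpleIntegral μ u =
      u.setToSimpleFunc (fun E => μ.1 E • ContinuousLinearMap.id ℝ ℝ) := fun u => by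
    simp [simpleIntegral, SimpleFunc.setToSimpleFunc, mul_comm]
  rw [key, key, key]
  refine SimpleFunc.setToSimpleFunc_sub (μ := (0 : Measure Ω)) _ ?_ (by simp) (by simp)
  intro E F hE hF _ _ hEF
  simp only [μ.2.2.1 E F hE hF hEF, add_smul]

/-- Integration of simple functions is Lipschitz for the uniform norm. -/
theorem exists_simpleIntegral_lipschitz (μ : ba Ω) :
    ∃ K : ℝ, 0 ≤ K ∧ ∀ (s t : SimpleFunc Ω ℝ) (δ : ℝ), 0 ≤ δ → (∀ ω, |s ω - t ω| ≤ δ) →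
      |simpleIntegral μ s - simpleIntegral μ t| ≤ K * δ := by
  obtain ⟨-, -, C, hC⟩ := μ.2
  have hC0 : 0 ≤ C := (abs_nonneg _).trans (hC ∅)
  refine ⟨2 * C, by positivity, fun s t δ hδ h => ?_⟩
  rw [← simpleIntegral_sub]
  set u := s - t with hu
  have hb : ∀ y ∈ u.range, |y| ≤ δ := by
    intro y hy
    obtain ⟨ω, rfl⟩ := SimpleFunc.mem_range.1 hy
    exact h ω
  calc |simpleIntegral μ u| ≤ ∑ y ∈ u.range, |y * μ.1 (u ⁻¹' {y})| :=
        Finset.abs_sum_le_sum_abs _ _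
    _ ≤ ∑ y ∈ u.range, δ * |μ.1 (u ⁻¹' {y})| := by
        refine Finset.sum_le_sum fun y hy => ?_
        rw [abs_mul]
        exact mul_le_mul_of_nonneg_right (hb y hy) (abs_nonneg _)
    _ = δ * ∑ y ∈ u.range, |μ.1 (u ⁻¹' {y})| := by rw [Finset.mul_sum]
    _ ≤ δ * (2 * C) := by
        refine mul_le_mul_of_nonneg_left ?_ hδ
        classical
        rw [← Finset.sum_filter_add_sum_filter_not _ (fun y => 0 ≤ μ.1 (u ⁻¹' {y})),
          Finset.sum_congr rfl (fun y hy => abs_of_nonneg (Finset.mem_filter.1 hy).2),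
          Finset.sum_congr (rfl : Finset.filter (fun y => ¬ 0 ≤ μ.1 (u ⁻¹' {y})) u.range = _)
            (fun y hy => abs_of_neg (not_le.1 (Finset.mem_filter.1 hy).2)),
          Finset.sum_neg_distrib, ← ba_biUnion, ← ba_biUnion]
        have h1 := le_of_abs_le (hC (u ⁻¹'
          (Finset.filter (fun y => 0 ≤ μ.1 (u ⁻¹' {y})) u.range : Finset ℝ)))
        have h2 := neg_le_of_abs_le (hC (u ⁻¹'
          (Finset.filter (fun y => ¬ 0 ≤ μ.1 (u ⁻¹' {y})) u.range : Finset ℝ)))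
        linarith
    _ = 2 * C * δ := by ring

/-- The limit that defines `integral` exists. -/
theorem tendsto_simpleIntegral (μ : ba Ω) (h : B Ω) :
    Tendsto (simpleIntegral μ) (uniformNear h) (𝓝 (integral μ h)) := by
  apply tendsto_nhds_limUnder
  obtain ⟨K, hK, hL⟩ := exists_simpleIntegral_lipschitz μ
  have hc : Cauchy (map (simpleIntegral μ) (uniformNear h)) := by
    rw [Metric.cauchy_iff]
    refine ⟨inferInstance, fun ε hε => ?_⟩
    have hδ : 0 < ε / (2 * K + 1) / 2 := by positivity
    refine ⟨_, image_mem_map ((hasBasis_uniformNear h).mem_of_mem hδ), ?_⟩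
    rintro _ ⟨s, hs, rfl⟩ _ ⟨t, ht, rfl⟩
    have := hL s t (ε / (2 * K + 1)) (by positivity) (fun ω => by
      have a := abs_le.1 (hs ω)
      have b := abs_le.1 (ht ω)
      rw [abs_le]
      constructor <;> linarith [a.1, a.2, b.1, b.2])
    rw [Real.dist_eq]
    refine this.trans_lt ?_
    rw [mul_div_assoc', div_lt_iff₀ (by positivity)]
    nlinarith
  exact CompleteSpace.complete hc

/-! ### Extended-real-valued functions -/

/-- The integral of an extended-real-valued function against a measure, as the integral of the
positive part minus the integral of the negative part. -/
def eintegral (Q : Measure Ω) (g : Ω → EReal) : EReal :=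
  ((∫⁻ ω, (g ω).toENNReal ∂Q : ℝ≥0∞) : EReal) - ((∫⁻ ω, (-g ω).toENNReal ∂Q : ℝ≥0∞) : EReal)

/-- Convexity of an extended-real-valued function on a real vector space: its epigraph is
convex. -/
def EConvex {E : Type*} [AddCommGroup E] [Module ℝ E] (g : E → EReal) : Prop :=
  Convex ℝ {p : E × ℝ | g p.1 ≤ (p.2 : EReal)}

/-- The functions `f : ℝ → (-∞, ∞]` that define an `f`-divergence. -/
structure IsDivergenceFunction (f : ℝ → EReal) : Prop where
  ne_bot : ∀ x, f x ≠ ⊥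
  lsc : LowerSemicontinuous f
  convex : EConvex f
  map_one : f 1 = 0
  finite_near_one : ∀ᶠ x in 𝓝 (1 : ℝ), f x ≠ ⊤
  top_of_neg : ∀ x, x < 0 → f x = ⊤

/-- The convex conjugate `f*(s) = sup_x (x s - f x)`. -/
def conjFun (f : ℝ → EReal) (s : ℝ) : EReal :=
  ⨆ x : ℝ, ((x * s : ℝ) : EReal) - f x

/-- The convex conjugate of a functional on `B(Ω, Σ)`, as a functional on `ba(Ω, Σ)`. -/
def conjReg (l : B Ω → EReal) (μ : ba Ω) : EReal :=
  ⨆ h : B Ω, (integral μ h : EReal) - l h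

/-- Shift invariance of a functional on `B(Ω, Σ)`. -/
def ShiftInvariant (l : B Ω → EReal) : Prop :=
  ∀ (h : B Ω) (b : ℝ), l h = l (h + B.const Ω b)

/-! ### The divergences -/

/-- The `f`-divergence `D_f(P‖Q) = ∫ f(dP/dQ) dQ` of measures with `P ≪ Q`. -/
def fDiv (f : ℝ → EReal) (P Q : Measure Ω) : EReal :=
  eintegral Q (fun ω => f (P.rnDeriv Q ω).toReal)

open Classical in
/-- The extended `f`-divergence, for a finitely additive `P` that need not be absolutely
continuous. -/
def extFDiv (f : ℝ → EReal) (P : FinAddProb Ω) (Q : Measure Ω) : EReal :=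
  if h : IsCountablyAdditive P.1 ∧ AbsCont P.1 Q then fDiv f (toMeasure P h.1) Q
  else ⨆ h : B Ω, (integral P.1 h : EReal) - eintegral Q (fun ω => conjFun f (h.1 ω))

/-- The regularized restricted `f`-divergence `D_{f,λ}(P‖Q)`, with regularizer `l`. -/
def regFDiv (f : ℝ → EReal) (l : B Ω → EReal) (P : FinAddProb Ω) (Q : Measure Ω) : EReal :=
  ⨆ h : B Ω, (integral P.1 h : EReal) - eintegral Q (fun ω => conjFun f (h.1 ω)) - l h

end FDiv

end

noncomputable section

namespace FDiv

/-! ### Divergence functions and their conjugates -/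

section Conjugate

variable {f : ℝ → EReal}

/-! Write `Φ h = 𝔼_Q[f*(h)]`. The theorem is Fenchel–Rockafellar duality for `Φ` and `λ` on `B Ω`,
with an attained dual minimum.

The divergence `extFDiv f · Q` is the conjugate of `Φ` on all of `𝒫` (`extFDiv_eq_iSup`). In the
countably additive, absolutely continuous case, one inequality is Fenchel–Young integrated. The
other writes `f` as a supremum of countably many affine minorants: finite maxima of these, evaluated
at `dP/dQ`, yield bounded test functions, and monotone convergence concludes. Weak duality then
follows from `𝔼_P = 𝔼_{P-P'} + 𝔼_{P'}`.

For the converse let `D` be the finite value of the primal problem. An algebraic Hahn–Banach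
argument gives a linear `ν` with `ν h - Φ h + (𝔼_P - ν) k - λ k ≤ D` for all `h`, `k`. No topology
or interior point is needed: any bounded function can be shifted down by a constant until `Φ` is
finite, and shifts cost nothing in `λ`. The inequality forces `ν` into the feasible set: `Φ` is
monotone, so `ν ≥ 0`; `Φ` ignores `Q`-null sets, so `ν ≪ Q`; `λ` ignores constants, so `ν 1 = 1`. A
positive functional on `B Ω` is integration against a finitely additive measure, so `ν` is the
required `P'`. Since the minimizer is absolutely continuous, the two infima agree. -/

theorem conjFun_mono (hneg : ∀ x < 0, f x = ⊤) : Monotone (conjFun f) := by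
  intro s t hst
  refine iSup_mono fun x => ?_
  -- Points `x < 0` contribute `⊥` to the supremum; for `x ≥ 0` the term increases with the slope.
  rcases lt_or_ge x 0 with hx | hx
  · simp [hneg x hx]
  · refine EReal.sub_le_sub ?_ le_rfl
    exact_mod_cast mul_le_mul_of_nonneg_left hst hx

/-- Test with `x = 1`. This is the integrable minorant that keeps `𝔼_Q[f*(h)]` away from `-∞`. -/
theorem le_conjFun (h1 : f 1 = 0) (s : ℝ) : (s : EReal) ≤ conjFun f s := by
  refine le_trans ?_ (le_iSup _ (1 : ℝ))
  simp [h1]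

/-- The Fenchel–Young inequality. -/
theorem coe_mul_le_add_conjFun {x s a b : ℝ} (ha : f x ≤ a) (hb : conjFun f s ≤ b) :
    x * s ≤ a + b := by
  have h : ((x * s : ℝ) : EReal) - a ≤ b :=
    (EReal.sub_le_sub le_rfl ha).trans ((le_iSup (fun x : ℝ => ((x * s : ℝ) : EReal) - f x) x).trans hb)
  have h' : x * s - a ≤ b := by exact_mod_cast h
  linarith

theorem conjFun_le_of_affine_le {s c : ℝ} (h : ∀ y : ℝ, ((s * y - c : ℝ) : EReal) ≤ f y) :
    conjFun f s ≤ c := by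
  refine iSup_le fun y => ?_
  refine (EReal.sub_le_sub le_rfl (h y)).trans ?_
  rw [← EReal.coe_sub, EReal.coe_le_coe_iff]
  linarith [mul_comm y s]

/-- The conjugate as a function with convex epigraph. -/
theorem conjFun_combo_le {s t a b α β : ℝ} (hα : 0 ≤ α) (hβ : 0 ≤ β) (hαβ : α + β = 1)
    (hbot : ∀ x, f x ≠ ⊥) (hs : conjFun f s ≤ a) (ht : conjFun f t ≤ b) :
    conjFun f (α * s + β * t) ≤ ((α * a + β * b : ℝ) : EReal) := by
  refine conjFun_le_of_affine_le fun y => ?_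
  by_cases hy : f y = ⊤
  · simp [hy]
  · lift f y to ℝ using ⟨hy, hbot y⟩ with z hz
    have h1 := coe_mul_le_add_conjFun hz.ge hs
    have h2 := coe_mul_le_add_conjFun hz.ge ht
    rw [EReal.coe_le_coe_iff]
    have h3 := mul_le_mul_of_nonneg_left h1 hα
    have h4 := mul_le_mul_of_nonneg_left h2 hβ
    have h5 : α * z + β * z = z := by rw [← add_mul, hαβ, one_mul]
    linarith

/-- A point strictly below the graph is separated from the epigraph by a possibly vertical line. -/
theorem exists_separating (hf : IsDivergenceFunction f) {x r : ℝ} (hr : (r : EReal) < f x) :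
    ∃ a b u : ℝ, 0 ≤ b ∧ a * x + b * r < u ∧ ∀ y t : ℝ, f y ≤ t → u < a * y + b * t := by
  have hcl : IsClosed {p : ℝ × ℝ | f p.1 ≤ (p.2 : EReal)} :=
    hf.lsc.isClosed_epigraph.preimage
      (f := fun p : ℝ × ℝ => (p.1, (p.2 : EReal)))
      (continuous_fst.prodMk (continuous_coe_real_ereal.comp continuous_snd))
  obtain ⟨L, u, h1, h2⟩ := geometric_hahn_banach_point_closed hf.convex hcl
    (x := (x, r)) (by simpa using hr)
  have hL : ∀ y t : ℝ, L (y, t) = L (1, 0) * y + L (0, 1) * t := fun y t => by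
    have : ((y, t) : ℝ × ℝ) = y • ((1, 0) : ℝ × ℝ) + t • ((0, 1) : ℝ × ℝ) := by simp
    rw [this, map_add, map_smul, map_smul, smul_eq_mul, smul_eq_mul]
    ring
  refine ⟨L (1, 0), L (0, 1), u, ?_, by rw [← hL]; exact h1, fun y t h => by
    rw [← hL]; exact h2 (y, t) h⟩
  -- The epigraph contains every `(1, t)` with `t ≥ 0`, so a negative coefficient of `t` would break
  -- the lower bound `u`.
  by_contra! hb
  have h3 : ∀ t : ℝ, 0 ≤ t → u < L (1, 0) + L (0, 1) * t := fun t ht => by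
    have := h2 (1, t) (by simpa [hf.map_one] using ht)
    rwa [hL, mul_one] at this
  have h4 := h3 0 le_rfl
  have h5 := h3 ((u - L (1, 0)) / L (0, 1))
    (div_nonneg_of_nonpos (by linarith) hb.le)
  rw [mul_div_cancel₀ _ hb.ne] at h5
  linarith

theorem affine_le_of_separating {a b u : ℝ} (hbot : ∀ x, f x ≠ ⊥) (hb : 0 < b)
    (h : ∀ y t : ℝ, f y ≤ t → u < a * y + b * t) (y : ℝ) :
    ((-a / b * y - -u / b : ℝ) : EReal) ≤ f y := by
  by_cases hy : f y = ⊤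
  · simp [hy]
  · have := hbot y
    lift f y to ℝ using ⟨hy, this⟩ with z hz
    have h1 := h y z hz.ge
    rw [EReal.coe_le_coe_iff, show -a / b * y - -u / b = (u - a * y) / b by ring,
      div_le_iff₀ hb]
    linarith

/-- Separate `(1, -1)` from the epigraph: `(1, 0)` belongs to it and lies on the same vertical, so
the separating line is not vertical. -/
theorem exists_affine_le (hf : IsDivergenceFunction f) :
    ∃ s c : ℝ, ∀ y : ℝ, ((s * y - c : ℝ) : EReal) ≤ f y := by
  obtain ⟨a, b, u, hb, h1, h2⟩ := exists_separating hf (x := 1) (r := -1)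
    (by rw [hf.map_one]; exact_mod_cast neg_one_lt_zero)
  have h3 := h2 1 0 (by simp [hf.map_one])
  exact ⟨_, _, affine_le_of_separating hf.ne_bot (by linarith) h2⟩

/-- A lower semicontinuous convex function is the supremum of its affine minorants. -/
theorem exists_affine_le_of_lt (hf : IsDivergenceFunction f) {x r : ℝ} (hr : (r : EReal) < f x) :
    ∃ s c : ℝ, (∀ y : ℝ, ((s * y - c : ℝ) : EReal) ≤ f y) ∧ r < s * x - c := by
  obtain ⟨a, b, u, hb, h1, h2⟩ := exists_separating hf hr
  rcases hb.eq_or_lt with rfl | hb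
  -- Vertical line: `a * y - u` is positive where `f` is finite and negative at `x`. Subtracting a
  -- large multiple of it from any affine minorant keeps a minorant and lifts the value at `x` above
  -- `r`.
  · obtain ⟨s, c, hsc⟩ := exists_affine_le hf
    obtain ⟨k, hk⟩ := exists_nat_gt ((r - (s * x - c)) / (u - a * x))
    have hux : 0 < u - a * x := by linarith
    refine ⟨s - k * a, c - k * u, fun y => ?_, ?_⟩
    · by_cases hy : f y = ⊤
      · simp [hy]
      · have hy' := hf.ne_bot y
        refine le_trans ?_ (hsc y)
        have h3 := h2 y (f y).toReal (EReal.le_coe_toReal hy)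
        rw [EReal.coe_le_coe_iff]
        have : 0 ≤ (k : ℝ) * (a * y - u) := mul_nonneg k.cast_nonneg (by linarith)
        linarith
    · rw [div_lt_iff₀ hux] at hk
      linarith
  · refine ⟨_, _, affine_le_of_separating hf.ne_bot hb h2, ?_⟩
    rw [show -a / b * x - -u / b = (u - a * x) / b by ring, lt_div_iff₀ hb]
    linarith

/-- Countably many affine minorants suffice. -/
theorem exists_seq_affine (hf : IsDivergenceFunction f) :
    ∃ s c : ℕ → ℝ, (∀ n, ∀ y : ℝ, ((s n * y - c n : ℝ) : EReal) ≤ f y) ∧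
      ∀ x r : ℝ, (r : EReal) < f x → ∃ n, r < s n * x - c n := by
  let I : Set (ℝ × ℝ) := {p | ∀ y : ℝ, ((p.1 * y - p.2 : ℝ) : EReal) ≤ f y}
  have : Nonempty I := by
    obtain ⟨s, c, h⟩ := exists_affine_le hf
    exact ⟨⟨(s, c), h⟩⟩
  refine ⟨fun n => (TopologicalSpace.denseSeq I n).1.1, fun n => (TopologicalSpace.denseSeq I n).1.2,
    fun n => (TopologicalSpace.denseSeq I n).2, fun x r hr => ?_⟩
  obtain ⟨s, c, h, h'⟩ := exists_affine_le_of_lt hf hr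
  -- Exceeding `r` at `x` is an open condition on the pair of slope and intercept, so a dense
  -- sequence of minorants meets it.
  have ho : IsOpen {p : I | r < p.1.1 * x - p.1.2} :=
    isOpen_lt continuous_const (by fun_prop)
  obtain ⟨n, hn⟩ :=
    (TopologicalSpace.denseRange_denseSeq I).exists_mem_open ho ⟨⟨(s, c), h⟩, h'⟩
  exact ⟨n, hn⟩

/-- The maximum of finitely many affine minorants has a measurable choice of slope. -/
theorem exists_measurable_slope {s c : ℕ → ℝ}
    (hsc : ∀ n, ∀ y : ℝ, ((s n * y - c n : ℝ) : EReal) ≤ f y) (n : ℕ) :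
    ∃ g d : ℝ → ℝ, Measurable g ∧ Measurable d ∧ (∃ C, ∀ x, |g x| ≤ C) ∧ (∃ C, ∀ x, |d x| ≤ C) ∧
      (∀ x y : ℝ, ((g x * y - d x : ℝ) : EReal) ≤ f y) ∧
      ∀ x, g x * x - d x = partialSups (fun i => s i * x - c i) n := by
  induction n with
  | zero =>
    exact ⟨fun _ => s 0, fun _ => c 0, measurable_const, measurable_const, ⟨_, fun _ => le_rfl⟩,
      ⟨_, fun _ => le_rfl⟩, fun _ => hsc 0, fun x => by simp⟩
  | succ n ih =>
    obtain ⟨g, d, hg, hd, ⟨C, hC⟩, ⟨D, hD⟩, h, hm⟩ := ih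
    have hset : MeasurableSet {x | g x * x - d x ≤ s (n + 1) * x - c (n + 1)} :=
      measurableSet_le (by fun_prop) (by fun_prop)
    refine ⟨fun x => if g x * x - d x ≤ s (n + 1) * x - c (n + 1) then s (n + 1) else g x,
      fun x => if g x * x - d x ≤ s (n + 1) * x - c (n + 1) then c (n + 1) else d x,
      Measurable.ite hset measurable_const hg, Measurable.ite hset measurable_const hd,
      ⟨max C |s (n + 1)|, fun x => ?_⟩, ⟨max D |c (n + 1)|, fun x => ?_⟩, fun x y => ?_,
      fun x => ?_⟩
    · dsimp only; split_ifs <;> simp [hC x]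
    · dsimp only; split_ifs <;> simp [hD x]
    · dsimp only; split_ifs
      exacts [hsc _ y, h x y]
    · rw [← Order.succ_eq_add_one, partialSups_succ, ← hm x, Order.succ_eq_add_one]
      dsimp only
      split_ifs with hx
      · exact (sup_eq_right.2 hx).symm
      · exact (sup_eq_left.2 (not_le.1 hx).le).symm

end Conjugate

/-! ### The extended integral -/

section EIntegral

variable {Ω : Type*} [MeasurableSpace Ω] {Q : Measure Ω}

theorem eintegral_mono_ae {u v : Ω → EReal} (h : ∀ᵐ ω ∂Q, u ω ≤ v ω) :
    eintegral Q u ≤ eintegral Q v := by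
  refine EReal.sub_le_sub ?_ ?_
  · exact_mod_cast lintegral_mono_ae (h.mono fun ω hω => EReal.toENNReal_le_toENNReal hω)
  · exact_mod_cast lintegral_mono_ae
      (h.mono fun ω hω => EReal.toENNReal_le_toENNReal (EReal.neg_le_neg_iff.2 hω))

theorem eintegral_coe {w : Ω → ℝ} (hw : Integrable w Q) :
    eintegral Q (fun ω => (w ω : EReal)) = ((∫ ω, w ω ∂Q : ℝ) : EReal) := by
  have h1 : ∫⁻ ω, ENNReal.ofReal (w ω) ∂Q ≠ ⊤ := hw.lintegral_lt_top.ne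
  have h2 : ∫⁻ ω, ENNReal.ofReal (-w ω) ∂Q ≠ ⊤ := hw.neg.lintegral_lt_top.ne
  rw [integral_eq_lintegral_pos_part_sub_lintegral_neg_part hw, EReal.coe_sub, eintegral]
  simp only [← EReal.coe_neg, EReal.real_coe_toENNReal]
  rw [EReal.coe_ennreal_toReal h1, EReal.coe_ennreal_toReal h2]

theorem integral_le_eintegral {u : Ω → EReal} {v : Ω → ℝ} (hv : Integrable v Q)
    (h : ∀ᵐ ω ∂Q, (v ω : EReal) ≤ u ω) : ((∫ ω, v ω ∂Q : ℝ) : EReal) ≤ eintegral Q u :=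
  (eintegral_coe hv).ge.trans (eintegral_mono_ae h)

theorem eintegral_le_integral {u : Ω → EReal} {v : Ω → ℝ} (hv : Integrable v Q)
    (h : ∀ᵐ ω ∂Q, u ω ≤ (v ω : EReal)) : eintegral Q u ≤ ((∫ ω, v ω ∂Q : ℝ) : EReal) :=
  (eintegral_mono_ae h).trans (eintegral_coe hv).le

/-- A function with an integrable minorant and extended integral less than `∞` is integrable. -/
theorem exists_integrable_ae_eq {u : Ω → EReal} {v : Ω → ℝ} (hu : Measurable u)
    (hv : Integrable v Q) (h : ∀ᵐ ω ∂Q, (v ω : EReal) ≤ u ω) (hfin : eintegral Q u ≠ ⊤) :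
    ∃ w : Ω → ℝ, Integrable w Q ∧ ∀ᵐ ω ∂Q, u ω = (w ω : EReal) := by
  have hneg : ∫⁻ ω, (-u ω).toENNReal ∂Q ≠ ⊤ := by
    refine ne_top_of_le_ne_top hv.neg.lintegral_lt_top.ne (lintegral_mono_ae ?_)
    filter_upwards [h] with ω hω
    exact EReal.toENNReal_le_toENNReal (EReal.neg_le_neg_iff.2 hω)
  have hpos : ∫⁻ ω, (u ω).toENNReal ∂Q ≠ ⊤ := by
    intro hp
    refine hfin ?_
    rw [eintegral, hp]
    lift ∫⁻ ω, (-u ω).toENNReal ∂Q to NNReal using hneg with z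
    rfl
  have hum : Measurable fun ω => (u ω).toENNReal := by fun_prop
  have hnm : Measurable fun ω => (-u ω).toENNReal := by fun_prop
  refine ⟨fun ω => (u ω).toENNReal.toReal - (-u ω).toENNReal.toReal,
    (integrable_toReal_of_lintegral_ne_top hum.aemeasurable hpos).sub
      (integrable_toReal_of_lintegral_ne_top hnm.aemeasurable hneg), ?_⟩
  filter_upwards [ae_lt_top hum hpos, ae_lt_top hnm hneg] with ω h1 h2
  have h1' : u ω ≠ ⊤ := EReal.toENNReal_ne_top_iff.1 h1.ne
  have h2' : u ω ≠ ⊥ := fun hb => by simp [hb] at h2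
  lift u ω to ℝ using ⟨h1', h2'⟩ with z
  rw [← EReal.coe_neg, EReal.real_coe_toENNReal, EReal.real_coe_toENNReal, EReal.coe_eq_coe_iff]
  rcases le_total 0 z with hz | hz
  · rw [ENNReal.toReal_ofReal hz, ENNReal.ofReal_of_nonpos (by linarith)]; simp
  · rw [ENNReal.toReal_ofReal (neg_nonneg.2 hz), ENNReal.ofReal_of_nonpos hz]; simp

/-- Monotone convergence, as a bound for the integral of the supremum. -/
theorem eintegral_le_of_seq {u : Ω → EReal} {g : ℕ → Ω → ℝ} {a : ℝ}
    (hg : ∀ n, Integrable (g n) Q) (hmono : ∀ ω, Monotone fun n => g n ω)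
    (hu : ∀ ω, ∀ r : ℝ, (r : EReal) < u ω → ∃ n, r < g n ω) (ha : ∀ n, ∫ ω, g n ω ∂Q ≤ a) :
    eintegral Q u ≤ a := by
  -- Subtracting `g 0` makes the sequence nonnegative, as monotone convergence for `lintegral`
  -- requires.
  set F : ℕ → Ω → ℝ≥0∞ := fun n ω => ENNReal.ofReal (g n ω - g 0 ω) with hF
  have hFm : ∀ n, AEMeasurable (F n) Q := fun n =>
    ((hg n).sub (hg 0)).aemeasurable.ennreal_ofReal
  have hint : ∫⁻ ω, ⨆ n, F n ω ∂Q ≤ ENNReal.ofReal (a - ∫ ω, g 0 ω ∂Q) := by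
    rw [lintegral_iSup' hFm (ae_of_all _ fun ω m n hmn =>
      ENNReal.ofReal_le_ofReal (sub_le_sub_right (hmono ω hmn) _))]
    refine iSup_le fun n => ?_
    change ∫⁻ ω, ENNReal.ofReal ((g n - g 0) ω) ∂Q ≤ _
    rw [← ofReal_integral_eq_lintegral_ofReal ((hg n).sub (hg 0))
      (ae_of_all _ fun ω => sub_nonneg.2 (hmono ω (Nat.zero_le n))),
      integral_sub' (hg n) (hg 0)]
    exact ENNReal.ofReal_le_ofReal (sub_le_sub_right (ha n) _)
  have hne : ∫⁻ ω, ⨆ n, F n ω ∂Q ≠ ⊤ := ne_top_of_le_ne_top ENNReal.ofReal_ne_top hint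
  have hm : AEMeasurable (fun ω => ⨆ n, F n ω) Q := AEMeasurable.iSup hFm
  have hw := (integrable_toReal_of_lintegral_ne_top hm hne).add (hg 0)
  refine (eintegral_le_integral hw ?_).trans ?_
  -- If `u ω` exceeded `(⨆ n, F n ω).toReal + g 0 ω`, some `g n ω` would too, contrary to `F n ω ≤ ⨆
  -- n, F n ω`.
  · filter_upwards [ae_lt_top' hm hne] with ω hω
    refine le_of_not_gt fun hlt => ?_
    obtain ⟨n, hn⟩ := hu ω _ hlt
    have h1 : F n ω ≤ ⨆ n, F n ω := le_iSup (fun n => F n ω) n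
    have h2 := (ENNReal.ofReal_le_iff_le_toReal hω.ne).1 h1
    simp only [Pi.add_apply] at hn
    linarith
  · rw [EReal.coe_le_coe_iff, integral_add' (integrable_toReal_of_lintegral_ne_top hm hne) (hg 0),
      integral_toReal hm (ae_lt_top' hm hne)]
    have h0 : 0 ≤ a - ∫ ω, g 0 ω ∂Q := sub_nonneg.2 (ha 0)
    have := ENNReal.toReal_mono ENNReal.ofReal_ne_top hint
    rw [ENNReal.toReal_ofReal h0] at this
    linarith

end EIntegral

/-! ### Integration against finitely additive measures -/

section FinAdd

variable {Ω : Type*} [MeasurableSpace Ω]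

/-- The indicator function of a measurable set, as an element of `B(Ω, Σ)`. -/
def B.ind (E : Set Ω) (hE : MeasurableSet E) : B Ω :=
  ⟨E.indicator 1, measurable_one.indicator hE, 1, fun ω => by
    by_cases h : ω ∈ E <;> simp [h]⟩

/-- A simple function, as an element of `B(Ω, Σ)`. -/
def B.ofSimple (s : SimpleFunc Ω ℝ) : B Ω :=
  ⟨s, s.measurable, by
    obtain ⟨C, hC⟩ := s.exists_forall_norm_le
    exact ⟨C, hC⟩⟩

theorem B.ofSimple_eq_sum (s : SimpleFunc Ω ℝ) :
    B.ofSimple s = ∑ y ∈ s.range, y • B.ind (s ⁻¹' {y}) (s.measurableSet_fiber y) := by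
  ext ω
  rw [Submodule.coe_sum, Finset.sum_apply, Finset.sum_eq_single (s ω)]
  · simp [B.ofSimple, B.ind]
  · intro y _ hy
    simp [B.ind, hy.symm]
  · intro h
    exact absurd (s.mem_range_self ω) h

theorem integral_add (μ : ba Ω) (g h : B Ω) : integral μ (g + h) = integral μ g + integral μ h := by
  have h1 := ((tendsto_simpleIntegral μ g).comp tendsto_fst).add
    ((tendsto_simpleIntegral μ h).comp (tendsto_snd (f := uniformNear g)))
  have h2 : Tendsto (fun p : SimpleFunc Ω ℝ × SimpleFunc Ω ℝ => p.1 + p.2)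
      (uniformNear g ×ˢ uniformNear h) (uniformNear (g + h)) := by
    rw [((hasBasis_uniformNear g).prod (hasBasis_uniformNear h)).tendsto_iff
      (hasBasis_uniformNear (g + h))]
    refine fun ε hε => ⟨(ε / 2, ε / 2), ⟨half_pos hε, half_pos hε⟩, fun p hp ω => ?_⟩
    have a := abs_le.1 (hp.1 ω)
    have b := abs_le.1 (hp.2 ω)
    simp only [SimpleFunc.coe_add, Pi.add_apply, Submodule.coe_add]
    rw [abs_le]
    constructor <;> linarith [a.1, a.2, b.1, b.2]
  refine tendsto_nhds_unique ((tendsto_simpleIntegral μ (g + h)).comp h2) (h1.congr fun p => ?_)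
  have h3 := simpleIntegral_sub μ (p.1 + p.2) p.2
  rw [add_sub_cancel_right] at h3
  simp only [Function.comp_apply]
  linarith

theorem simpleIntegral_smul (μ : ba Ω) (c : ℝ) (s : SimpleFunc Ω ℝ) :
    simpleIntegral μ (c • s) = c * simpleIntegral μ s := by
  have key : ∀ u : SimpleFunc Ω ℝ, simpleIntegral μ u =
      u.setToSimpleFunc (fun E => μ.1 E • ContinuousLinearMap.id ℝ ℝ) := fun u => by
    simp [simpleIntegral, SimpleFunc.setToSimpleFunc, mul_comm]
  rw [key, key]
  refine SimpleFunc.setToSimpleFunc_smul_real (μ := (0 : Measure Ω)) _ ?_ c (by simp)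
  intro E F hE hF _ _ hEF
  simp only [μ.2.2.1 E F hE hF hEF, add_smul]

theorem integral_smul (μ : ba Ω) (c : ℝ) (h : B Ω) : integral μ (c • h) = c * integral μ h := by
  have h2 : Tendsto (fun s : SimpleFunc Ω ℝ => c • s) (uniformNear h) (uniformNear (c • h)) := by
    rw [(hasBasis_uniformNear h).tendsto_iff (hasBasis_uniformNear (c • h))]
    refine fun ε hε => ⟨ε / (|c| + 1), by positivity, fun s hs ω => ?_⟩
    simp only [SimpleFunc.coe_smul, Pi.smul_apply, Submodule.coe_smul, smul_eq_mul]
    rw [← mul_sub, abs_mul]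
    have h3 : |s ω - h.1 ω| * (|c| + 1) ≤ ε := (le_div_iff₀ (by positivity)).1 (hs ω)
    nlinarith [abs_nonneg (s ω - h.1 ω)]
  exact tendsto_nhds_unique ((tendsto_simpleIntegral μ (c • h)).comp h2)
    (((tendsto_simpleIntegral μ h).const_mul c).congr fun s => (simpleIntegral_smul μ c s).symm)

theorem integral_sub_left (μ ν : ba Ω) (h : B Ω) :
    integral (μ - ν) h = integral μ h - integral ν h := by
  refine tendsto_nhds_unique (tendsto_simpleIntegral (μ - ν) h)
    (((tendsto_simpleIntegral μ h).sub (tendsto_simpleIntegral ν h)).congr fun s => ?_)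
  simp [simpleIntegral, mul_sub]

/-- The simple function itself lies in every set of the filter, so the limit is the value there. -/
theorem integral_ofSimple (μ : ba Ω) (s : SimpleFunc Ω ℝ) :
    integral μ (B.ofSimple s) = simpleIntegral μ s := by
  refine tendsto_nhds_unique ((tendsto_simpleIntegral μ (B.ofSimple s)).mono_left ?_)
    (tendsto_pure_nhds (simpleIntegral μ) s)
  rw [pure_le_iff]
  intro S hS
  obtain ⟨ε, hε, hS⟩ := (hasBasis_uniformNear _).mem_iff.1 hS
  exact hS fun ω => by simpa [B.ofSimple] using hε.le

theorem integral_const (P : FinAddProb Ω) (b : ℝ) : integral P.1 (B.const Ω b) = b := by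
  -- The range of a constant simple function is a singleton only if `Ω` is nonempty, which `P univ =
  -- 1` ensures.
  have : Nonempty Ω := by
    by_contra hne
    rw [not_nonempty_iff] at hne
    exact zero_ne_one (((ba_empty P.1).symm.trans
      (congrArg P.1.1 (Set.univ_eq_empty_iff.2 hne).symm)).trans P.2.2)
  have h := integral_ofSimple P.1 (SimpleFunc.const Ω b)
  have h1 : (SimpleFunc.const Ω b : Ω → ℝ) ⁻¹' {b} = Set.univ := by ext; simp
  rw [simpleIntegral, SimpleFunc.range_const, Finset.sum_singleton, h1, P.2.2, mul_one] at h
  exact h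

/-- A positive linear functional is monotone. -/
theorem linear_mono {F : B Ω →ₗ[ℝ] ℝ} (hF : ∀ h : B Ω, (∀ ω, 0 ≤ h.1 ω) → 0 ≤ F h) {g h : B Ω}
    (hgh : ∀ ω, g.1 ω ≤ h.1 ω) : F g ≤ F h := by
  have := hF (h - g) fun ω => by simpa using hgh ω
  rw [map_sub] at this
  linarith

theorem smul_const_one (b : ℝ) : b • B.const Ω 1 = B.const Ω b := by
  ext ω
  simp [B.const]

/-- A positive linear functional is integration against its values on indicator functions. -/
theorem integral_eq_of_linear (μ : ba Ω) {F : B Ω →ₗ[ℝ] ℝ}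
    (hF : ∀ h : B Ω, (∀ ω, 0 ≤ h.1 ω) → 0 ≤ F h)
    (hμ : ∀ E hE, F (B.ind E hE) = μ.1 E) (h : B Ω) : integral μ h = F h := by
  have hs : ∀ s : SimpleFunc Ω ℝ, simpleIntegral μ s = F (B.ofSimple s) := fun s => by
    rw [B.ofSimple_eq_sum, map_sum, simpleIntegral]
    exact Finset.sum_congr rfl fun y _ => by rw [map_smul, hμ, smul_eq_mul]
  refine tendsto_nhds_unique (tendsto_simpleIntegral μ h) ?_
  rw [(hasBasis_uniformNear h).tendsto_iff Metric.nhds_basis_closedBall]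
  -- Positivity supplies continuity: `|s - h| ≤ δ` implies `|F s - F h| ≤ δ * F 1`. The `+ 1` below
  -- avoids dividing by zero.
  have h1 : 0 ≤ F (B.const Ω 1) := hF _ fun _ => zero_le_one
  refine fun ε hε => ⟨ε / (F (B.const Ω 1) + 1), by positivity, fun s hsh => ?_⟩
  set δ := ε / (F (B.const Ω 1) + 1) with hδ
  have hδε : δ * F (B.const Ω 1) ≤ ε := by
    rw [hδ, div_mul_eq_mul_div, div_le_iff₀ (by positivity)]
    nlinarith
  rw [Metric.mem_closedBall, Real.dist_eq, hs, abs_le]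
  have a : F h ≤ F (B.ofSimple s + δ • B.const Ω 1) := linear_mono hF fun ω => by
    have := abs_le.1 (hsh ω)
    simp only [B.ofSimple, B.const, Submodule.coe_add, Submodule.coe_smul, Pi.add_apply,
      Pi.smul_apply, smul_eq_mul]
    linarith [this.1]
  have b : F (B.ofSimple s) ≤ F (h + δ • B.const Ω 1) := linear_mono hF fun ω => by
    have := abs_le.1 (hsh ω)
    simp only [B.ofSimple, B.const, Submodule.coe_add, Submodule.coe_smul, Pi.add_apply,
      Pi.smul_apply, smul_eq_mul]
    linarith [this.2]
  rw [map_add, map_smul, smul_eq_mul] at a b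
  constructor <;> linarith

open Classical in
/-- The finitely additive probability measure given by a positive, normalized linear functional. -/
def FinAddProb.ofLinear (F : B Ω →ₗ[ℝ] ℝ) (hF : ∀ h : B Ω, (∀ ω, 0 ≤ h.1 ω) → 0 ≤ F h)
    (h1 : F (B.const Ω 1) = 1) : FinAddProb Ω :=
  have h0 : ∀ E hE, 0 ≤ F (B.ind E hE) := fun _ _ =>
    hF _ fun _ => Set.indicator_nonneg (fun _ _ => zero_le_one) _
  ⟨⟨fun E => if hE : MeasurableSet E then F (B.ind E hE) else 0, fun E hE => by simp [hE],
    fun E G hE hG hEG => by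
      dsimp only
      rw [dif_pos hE, dif_pos hG, dif_pos (hE.union hG), ← map_add]
      congr 1
      ext ω
      exact congrFun (Set.indicator_union_of_disjoint hEG 1) ω, 1, fun E => by
      dsimp only
      split_ifs with hE
      · rw [abs_of_nonneg (h0 E hE), ← h1]
        exact linear_mono hF fun ω => Set.indicator_le_self' (fun _ _ => zero_le_one) ω
      · simp⟩,
    fun E => by
      dsimp only
      split_ifs with hE
      exacts [h0 E hE, le_rfl], by
      dsimp only
      rw [dif_pos .univ, ← h1]
      congr 1
      ext ω
      simp [B.ind, B.const]⟩

section OfLinear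

variable {F : B Ω →ₗ[ℝ] ℝ} {hF : ∀ h : B Ω, (∀ ω, 0 ≤ h.1 ω) → 0 ≤ F h} {h1 : F (B.const Ω 1) = 1}

theorem FinAddProb.ofLinear_apply {E : Set Ω} (hE : MeasurableSet E) :
    (FinAddProb.ofLinear F hF h1).1.1 E = F (B.ind E hE) :=
  dif_pos hE

theorem integral_ofLinear (h : B Ω) : integral (FinAddProb.ofLinear F hF h1).1 h = F h :=
  integral_eq_of_linear _ hF (fun _ hE => (FinAddProb.ofLinear_apply hE).symm) h

end OfLinear

theorem integrable_of_mem_B (h : B Ω) (m : Measure Ω) [IsFiniteMeasure m] : Integrable h.1 m := by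
  obtain ⟨hm, C, hC⟩ := h.2
  exact Integrable.of_bound hm.aestronglyMeasurable C (ae_of_all _ hC)

/-- Integration against a finite measure, as a linear functional on `B(Ω, Σ)`. -/
def measureIntegral (m : Measure Ω) [IsFiniteMeasure m] : B Ω →ₗ[ℝ] ℝ where
  toFun h := ∫ ω, h.1 ω ∂m
  map_add' g h := MeasureTheory.integral_add (integrable_of_mem_B g m) (integrable_of_mem_B h m)
  map_smul' c h := MeasureTheory.integral_const_mul c h.1

theorem measureIntegral_nonneg (m : Measure Ω) [IsFiniteMeasure m] (h : B Ω)
    (h0 : ∀ ω, 0 ≤ h.1 ω) : 0 ≤ measureIntegral m h :=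
  MeasureTheory.integral_nonneg h0

theorem measureIntegral_ind (m : Measure Ω) [IsFiniteMeasure m] (E : Set Ω) (hE : MeasurableSet E) :
    measureIntegral m (B.ind E hE) = m.real E :=
  integral_indicator_one hE

/-- A countably additive probability measure, as an element of `𝒫(Ω, Σ)`. -/
def FinAddProb.ofMeasure (Q : Measure Ω) [IsProbabilityMeasure Q] : FinAddProb Ω :=
  .ofLinear (measureIntegral Q) (measureIntegral_nonneg Q) (by simp [measureIntegral, B.const])

theorem absCont_ofMeasure (Q : Measure Ω) [IsProbabilityMeasure Q] :
    AbsCont (FinAddProb.ofMeasure Q).1 Q := fun E hE h => by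
  rw [FinAddProb.ofMeasure, FinAddProb.ofLinear_apply hE, measureIntegral_ind, Measure.real, h]
  rfl

theorem toMeasure_apply (P : FinAddProb Ω) (hP : IsCountablyAdditive P.1) {E : Set Ω}
    (hE : MeasurableSet E) : toMeasure P hP E = ENNReal.ofReal (P.1.1 E) :=
  Measure.ofMeasurable_apply E hE

theorem isProbabilityMeasure_toMeasure (P : FinAddProb Ω) (hP : IsCountablyAdditive P.1) :
    IsProbabilityMeasure (toMeasure P hP) :=
  ⟨by rw [toMeasure_apply P hP .univ, P.2.2, ENNReal.ofReal_one]⟩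

theorem integral_toMeasure (P : FinAddProb Ω) (hP : IsCountablyAdditive P.1) (h : B Ω) :
    ∫ ω, h.1 ω ∂(toMeasure P hP) = integral P.1 h := by
  have := isProbabilityMeasure_toMeasure P hP
  refine (integral_eq_of_linear P.1 (measureIntegral_nonneg (toMeasure P hP)) (fun E hE => ?_) h).symm
  rw [measureIntegral_ind, Measure.real, toMeasure_apply P hP hE, ENNReal.toReal_ofReal (P.2.1 E)]

theorem toMeasure_absolutelyContinuous (P : FinAddProb Ω) (hP : IsCountablyAdditive P.1)
    {Q : Measure Ω} (h : AbsCont P.1 Q) : toMeasure P hP ≪ Q :=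
  Measure.AbsolutelyContinuous.mk fun E hE hQ => by
    rw [toMeasure_apply P hP hE, h E hE hQ, ENNReal.ofReal_zero]

end FinAdd

/-! ### The integral of the conjugate and the variational formula -/

section Variational

variable {Ω : Type*} [MeasurableSpace Ω] {f : ℝ → EReal} {Q : Measure Ω}

/-- The functional `h ↦ 𝔼_Q[f*(h)]` on `B(Ω, Σ)`. -/
def conjIntegral (f : ℝ → EReal) (Q : Measure Ω) (h : B Ω) : EReal :=
  eintegral Q fun ω => conjFun f (h.1 ω)

/-- The comparison is only `Q`-almost everywhere, so this gives both positivity and absolute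
continuity of the dual functional. -/
theorem conjIntegral_mono (hf : IsDivergenceFunction f) {g h : B Ω}
    (hgh : ∀ᵐ ω ∂Q, g.1 ω ≤ h.1 ω) : conjIntegral f Q g ≤ conjIntegral f Q h :=
  eintegral_mono_ae (hgh.mono fun _ hω => conjFun_mono hf.top_of_neg hω)

variable [IsProbabilityMeasure Q]

theorem conjIntegral_ne_bot (hf : IsDivergenceFunction f) (h : B Ω) : conjIntegral f Q h ≠ ⊥ :=
  ne_bot_of_le_ne_bot (EReal.coe_ne_bot _)
    (integral_le_eintegral (integrable_of_mem_B h Q) (ae_of_all _ fun _ => le_conjFun hf.map_one _))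

theorem exists_integrable_conjFun (hf : IsDivergenceFunction f) {h : B Ω}
    (hfin : conjIntegral f Q h ≠ ⊤) :
    ∃ w : Ω → ℝ, Integrable w Q ∧ (∀ᵐ ω ∂Q, conjFun f (h.1 ω) = w ω) ∧
      conjIntegral f Q h = ((∫ ω, w ω ∂Q : ℝ) : EReal) := by
  obtain ⟨w, hw, h1⟩ := exists_integrable_ae_eq ((conjFun_mono hf.top_of_neg).measurable.comp h.2.1)
    (integrable_of_mem_B h Q) (ae_of_all _ fun _ => le_conjFun hf.map_one _) hfin
  exact ⟨w, hw, h1, le_antisymm (eintegral_le_integral hw (h1.mono fun _ h => h.le))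
    (integral_le_eintegral hw (h1.mono fun _ h => h.ge))⟩

/-- Finite upper bounds make both conjugates `Q`-integrable, so pointwise convexity can be
integrated without meeting `∞ - ∞`. -/
theorem conjIntegral_combo_le (hf : IsDivergenceFunction f) {g h : B Ω} {a b α β : ℝ} (hα : 0 ≤ α)
    (hβ : 0 ≤ β) (hαβ : α + β = 1) (hg : conjIntegral f Q g ≤ a) (hh : conjIntegral f Q h ≤ b) :
    conjIntegral f Q (α • g + β • h) ≤ ((α * a + β * b : ℝ) : EReal) := by
  obtain ⟨v, hv, hv1, hv2⟩ := exists_integrable_conjFun hf (ne_top_of_le_ne_top (EReal.coe_ne_top _) hg)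
  obtain ⟨w, hw, hw1, hw2⟩ := exists_integrable_conjFun hf (ne_top_of_le_ne_top (EReal.coe_ne_top _) hh)
  rw [hv2, EReal.coe_le_coe_iff] at hg
  rw [hw2, EReal.coe_le_coe_iff] at hh
  refine (eintegral_le_integral ((hv.const_mul α).add (hw.const_mul β)) ?_).trans ?_
  · filter_upwards [hv1, hw1] with ω h1 h2
    exact conjFun_combo_le hα hβ hαβ hf.ne_bot h1.le h2.le
  · rw [EReal.coe_le_coe_iff, integral_add' (hv.const_mul α) (hw.const_mul β),
      integral_const_mul, integral_const_mul]
    exact add_le_add (mul_le_mul_of_nonneg_left hg hα) (mul_le_mul_of_nonneg_left hh hβ)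

/-- An affine minorant of `f` with slope `s` bounds `f*` at `s`, hence on `(-∞, s]` by monotonicity.
-/
theorem exists_conjIntegral_le (hf : IsDivergenceFunction f) (Q : Measure Ω)
    [IsProbabilityMeasure Q] :
    ∃ s c : ℝ, ∀ h : B Ω, (∀ ω, h.1 ω ≤ s) → conjIntegral f Q h ≤ c := by
  obtain ⟨s, c, hsc⟩ := exists_affine_le hf
  refine ⟨s, c, fun h hs => ?_⟩
  refine (eintegral_le_integral (integrable_const c) (ae_of_all _ fun ω => ?_)).trans (by simp)
  exact (conjFun_mono hf.top_of_neg (hs ω)).trans (conjFun_le_of_affine_le hsc)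

/-- A bounded function can be shifted below `s`. Together with shift invariance of `λ`, this plays
the role of a constraint qualification. -/
theorem exists_const_conjIntegral_le (hf : IsDivergenceFunction f) (Q : Measure Ω)
    [IsProbabilityMeasure Q] :
    ∃ c : ℝ, ∀ h : B Ω, ∃ b : ℝ, conjIntegral f Q (h + B.const Ω b) ≤ c := by
  obtain ⟨s, c, hsc⟩ := exists_conjIntegral_le hf Q
  refine ⟨c, fun h => ?_⟩
  obtain ⟨C, hC⟩ := h.2.2
  refine ⟨s - C, hsc _ fun ω => ?_⟩
  have := (abs_le.1 (hC ω)).2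
  simp only [B.const, Submodule.coe_add, Pi.add_apply]
  linarith

theorem integrable_rnDeriv_mul (m : Measure Ω) [IsFiniteMeasure m] (hm : m ≪ Q) (h : B Ω) :
    Integrable (fun ω => (m.rnDeriv Q ω).toReal * h.1 ω) Q :=
  (integrable_rnDeriv_smul_iff hm).2 (integrable_of_mem_B h m)

/-- Fenchel–Young at the pair `dm/dQ`, `h`, integrated against `Q`. -/
theorem sub_conjIntegral_le_fDiv (hf : IsDivergenceFunction f) (m : Measure Ω) [IsFiniteMeasure m]
    (hm : m ≪ Q) (h : B Ω) :
    ((∫ ω, h.1 ω ∂m : ℝ) : EReal) - conjIntegral f Q h ≤ fDiv f m Q := by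
  by_cases hfin : conjIntegral f Q h = ⊤
  · simp [hfin]
  obtain ⟨w, hw, hw1, hw2⟩ := exists_integrable_conjFun hf hfin
  have hi := integrable_rnDeriv_mul m hm h
  rw [hw2, ← integral_rnDeriv_smul hm, ← EReal.coe_sub]
  simp only [smul_eq_mul]
  rw [← integral_sub hi hw]
  refine integral_le_eintegral (hi.sub hw) (hw1.mono fun ω hω => ?_)
  by_cases ht : f (m.rnDeriv Q ω).toReal = ⊤
  · simp [ht]
  · have hb := hf.ne_bot (m.rnDeriv Q ω).toReal
    have := coe_mul_le_add_conjFun (EReal.le_coe_toReal ht) hω.le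
    rw [← EReal.coe_toReal ht hb, EReal.coe_le_coe_iff]
    linarith

theorem fDiv_le_iSup (hf : IsDivergenceFunction f) (m : Measure Ω) [IsFiniteMeasure m]
    (hm : m ≪ Q) :
    fDiv f m Q ≤ ⨆ h : B Ω, ((∫ ω, h.1 ω ∂m : ℝ) : EReal) - conjIntegral f Q h := by
  refine EReal.le_of_forall_lt_iff_le.1 fun a ha => ?_
  obtain ⟨s, c, hsc, hsup⟩ := exists_seq_affine hf
  set p : Ω → ℝ := fun ω => (m.rnDeriv Q ω).toReal with hp
  have hpm : Measurable p := (m.measurable_rnDeriv Q).ennreal_toReal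
  have key : ∀ n, Integrable (fun ω => partialSups (fun i => s i * p ω - c i) n) Q ∧
      ∫ ω, partialSups (fun i => s i * p ω - c i) n ∂Q ≤ a := fun n => by
    -- The maximum of the first affine minorants at `p = dm/dQ` is `g(p) p - d(p)`. The bounded
    -- function `g ∘ p` serves as the test function, and `f*(g(p)) ≤ d(p)`.
    obtain ⟨g, d, hg, hd, ⟨C, hC⟩, ⟨D, hD⟩, h, hmax⟩ := exists_measurable_slope hsc n
    let hn : B Ω := ⟨fun ω => g (p ω), hg.comp hpm, C, fun ω => hC _⟩
    let dn : B Ω := ⟨fun ω => d (p ω), hd.comp hpm, D, fun ω => hD _⟩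
    have h1 : Integrable (fun ω => p ω * g (p ω)) Q := integrable_rnDeriv_mul m hm hn
    have h2 : Integrable (fun ω => d (p ω)) Q := integrable_of_mem_B dn Q
    have h3 : (fun ω => partialSups (fun i => s i * p ω - c i) n) =
        fun ω => p ω * g (p ω) - d (p ω) := by
      ext ω
      rw [← hmax, mul_comm]
    have h4 : conjIntegral f Q hn ≤ ((∫ ω, d (p ω) ∂Q : ℝ) : EReal) :=
      eintegral_le_integral h2 (ae_of_all _ fun ω => conjFun_le_of_affine_le (h (p ω)))
    have h5 := (le_iSup (fun h : B Ω => ((∫ ω, h.1 ω ∂m : ℝ) : EReal) - conjIntegral f Q h) hn).trans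
      ha.le
    rw [h3]
    refine ⟨h1.sub h2, ?_⟩
    rw [integral_sub h1 h2, ← EReal.coe_le_coe_iff, EReal.coe_sub]
    refine le_trans (EReal.sub_le_sub ?_ h4) h5
    rw [← integral_rnDeriv_smul hm]
    exact le_rfl
  exact eintegral_le_of_seq (fun n => (key n).1) (fun ω => (partialSups _).monotone)
    (fun ω r hr => (hsup _ r hr).imp fun n hn =>
      hn.trans_le (le_partialSups (fun i => s i * p ω - c i) n)) fun n => (key n).2

/-- The variational formula for the extended divergence, valid for every `P`. -/
theorem extFDiv_eq_iSup (hf : IsDivergenceFunction f) (P : FinAddProb Ω) :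
    extFDiv f P Q = ⨆ h : B Ω, (integral P.1 h : EReal) - conjIntegral f Q h := by
  rw [extFDiv]
  split_ifs with hP
  · have := isProbabilityMeasure_toMeasure P hP.1
    have hm := toMeasure_absolutelyContinuous P hP.1 hP.2
    simp only [← integral_toMeasure P hP.1]
    exact le_antisymm (fDiv_le_iSup hf _ hm) (iSup_le (sub_conjIntegral_le_fDiv hf _ hm))
  · rfl

theorem extFDiv_ne_bot (hf : IsDivergenceFunction f) (P : FinAddProb Ω) : extFDiv f P Q ≠ ⊥ := by
  obtain ⟨c, hc⟩ := exists_const_conjIntegral_le hf Q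
  obtain ⟨b, hb⟩ := hc 0
  rw [extFDiv_eq_iSup hf]
  refine ne_bot_of_le_ne_bot ?_ ((EReal.sub_le_sub le_rfl hb).trans
    (le_iSup (fun h : B Ω => (integral P.1 h : EReal) - conjIntegral f Q h) _))
  rw [← EReal.coe_sub]
  exact EReal.coe_ne_bot _

end Variational

/-! ### Duality -/

theorem nonpos_of_forall_mul_le {x C : ℝ} (h : ∀ t : ℝ, 0 ≤ t → t * x ≤ C) : x ≤ 0 := by
  by_contra! hx
  obtain ⟨n, hn⟩ := exists_nat_gt (C / x)
  rw [div_lt_iff₀ hx] at hn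
  exact absurd (h n n.cast_nonneg) (not_le.2 hn)

/-- The algebraic Hahn–Banach theorem, for a convex set that projects onto the whole space. -/
theorem exists_linear_le_of_convex {E : Type*} [AddCommGroup E] [Module ℝ E] {A : Set (E × ℝ)}
    (hA : Convex ℝ A) (h0 : ∀ r, ((0 : E), r) ∈ A → 0 ≤ r) (hproj : ∀ u, ∃ r, (u, r) ∈ A) :
    ∃ G : E →ₗ[ℝ] ℝ, ∀ u r, (u, r) ∈ A → G u ≤ r := by
  -- `K` is the cone generated by `A`. The functional `(0, r) ↦ r` is nonnegative on `K ∩ ({0} × ℝ)`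
  -- by `h0`, and `hproj` is the cofinality that the Riesz extension theorem needs.
  let K : PointedCone ℝ (E × ℝ) :=
    { carrier := {x | x = 0 ∨ ∃ t : ℝ, 0 < t ∧ ∃ y ∈ A, x = t • y}
      zero_mem' := Or.inl rfl
      add_mem' := by
        rintro x x' (rfl | ⟨t, ht, y, hy, rfl⟩) hx'
        · rwa [zero_add]
        rcases hx' with rfl | ⟨t', ht', y', hy', rfl⟩
        · exact Or.inr ⟨t, ht, y, hy, add_zero _⟩
        have htt : 0 < t + t' := add_pos ht ht'
        refine Or.inr ⟨t + t', htt, (t / (t + t')) • y + (t' / (t + t')) • y',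
          hA hy hy' (div_nonneg ht.le htt.le) (div_nonneg ht'.le htt.le)
            (by rw [← add_div, div_self htt.ne']), ?_⟩
        rw [smul_add, smul_smul, smul_smul, mul_div_cancel₀ _ htt.ne', mul_div_cancel₀ _ htt.ne']
      smul_mem' := by
        rintro ⟨c, hc⟩ x hx
        rcases hc.eq_or_lt with rfl | hc'
        · exact Or.inl (zero_smul ℝ x)
        rcases hx with rfl | ⟨t, ht, y, hy, rfl⟩
        · exact Or.inl (smul_zero _)
        · exact Or.inr ⟨c * t, mul_pos hc' ht, y, hy, smul_smul c t y⟩ }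
  let p : (E × ℝ) →ₗ.[ℝ] ℝ :=
    ⟨(⊥ : Submodule ℝ E).prod ⊤, (LinearMap.snd ℝ E ℝ).comp (Submodule.subtype _)⟩
  obtain ⟨g, hg, hgK⟩ := riesz_extension K p
    (by
      rintro ⟨⟨u, r⟩, hu⟩ hx
      obtain rfl : u = 0 := hu.1
      change 0 ≤ r
      rcases hx with hx | ⟨t, ht, ⟨u', r'⟩, hy, hx⟩
      · exact (congrArg Prod.snd hx).ge
      · obtain rfl : u' = 0 := by
          have := (congrArg Prod.fst hx).symm
          exact (smul_eq_zero.1 this).resolve_left ht.ne'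
        obtain rfl : r = t * r' := congrArg Prod.snd hx
        exact mul_nonneg ht.le (h0 r' hy))
    (by
      rintro ⟨u, r⟩
      obtain ⟨r', hr'⟩ := hproj u
      exact ⟨⟨(0, r' - r), rfl, trivial⟩, Or.inr ⟨1, one_pos, (u, r'), hr', by simp⟩⟩)
  -- On `A`, `0 ≤ g (u, r) = g (u, 0) + r`, so `-g (u, 0) ≤ r`.
  refine ⟨-(g.comp (LinearMap.inl ℝ E ℝ)), fun u r hur => ?_⟩
  have h1 : 0 ≤ g (u, r) := hgK _ (Or.inr ⟨1, one_pos, (u, r), hur, (one_smul _ _).symm⟩)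
  have h2 : g (0, r) = r := hg ⟨(0, r), rfl, trivial⟩
  have h3 : g (u, r) = g (u, 0) + g (0, r) := by rw [← map_add]; simp
  simp only [LinearMap.neg_apply, LinearMap.comp_apply, LinearMap.inl_apply]
  linarith

theorem EConvex.combo_le {E : Type*} [AddCommGroup E] [Module ℝ E] {g : E → EReal} (hg : EConvex g)
    {x y : E} {a b α β : ℝ} (hα : 0 ≤ α) (hβ : 0 ≤ β) (hαβ : α + β = 1) (hx : g x ≤ a)
    (hy : g y ≤ b) : g (α • x + β • y) ≤ ((α * a + β * b : ℝ) : EReal) :=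
  hg (x := (x, a)) (y := (y, b)) hx hy hα hβ hαβ

section Duality

variable {Ω : Type*} [MeasurableSpace Ω] {f : ℝ → EReal} {l : B Ω → EReal} {Q : Measure Ω}
  [IsProbabilityMeasure Q]

/-- Weak duality: split `𝔼_P h` as `𝔼_{P-P'} h + 𝔼_{P'} h` and use one `h` in both suprema. -/
theorem regFDiv_le_conjReg_add_extFDiv (hf : IsDivergenceFunction f) (P P' : FinAddProb Ω) :
    regFDiv f l P Q ≤ conjReg l (P.1 - P'.1) + extFDiv f P' Q := by
  refine iSup_le fun h => ?_
  change (integral P.1 h : EReal) - conjIntegral f Q h - l h ≤ _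
  have hl : (integral (P.1 - P'.1) h : EReal) - l h ≤ conjReg l (P.1 - P'.1) :=
    le_iSup (fun h => (integral (P.1 - P'.1) h : EReal) - l h) h
  have hd : (integral P'.1 h : EReal) - conjIntegral f Q h ≤ extFDiv f P' Q := by
    rw [extFDiv_eq_iSup hf]
    exact le_iSup (fun h => (integral P'.1 h : EReal) - conjIntegral f Q h) h
  have hbot := conjIntegral_ne_bot (Q := Q) hf h
  by_cases htop : conjIntegral f Q h = ⊤
  · simp [htop]
  lift conjIntegral f Q h to ℝ using ⟨htop, hbot⟩ with a
  by_cases hlt : l h = ⊤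
  · simp [hlt]
  by_cases hlb : l h = ⊥
  -- Here `λ*` is `⊤`, and the sum is `⊤` because the divergence is never `⊥`.
  · rw [hlb, EReal.coe_sub_bot, top_le_iff] at hl
    rw [hl, EReal.top_add_of_ne_bot (extFDiv_ne_bot hf P')]
    exact le_top
  lift l h to ℝ using ⟨hlt, hlb⟩ with b
  refine le_trans (le_of_eq ?_) (add_le_add hl hd)
  rw [integral_sub_left]
  norm_cast
  ring

/-- A linear functional that separates the two summands of the dual problem. -/
theorem exists_linear_add_le (hf : IsDivergenceFunction f) (hconv : EConvex l)
    (hshift : ShiftInvariant l) (P : FinAddProb Ω) {D b₀ : ℝ} {h₀ : B Ω} (h₀l : l h₀ ≤ b₀)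
    (hD : regFDiv f l P Q ≤ D) :
    ∃ ν : B Ω →ₗ[ℝ] ℝ, ∀ (h k : B Ω) (a b : ℝ), conjIntegral f Q h ≤ a → l k ≤ b →
      ν h - a + (integral P.1 k - ν k - b) ≤ D := by
  -- Over `u` lie upper bounds of the perturbed objective `Φ (k + u) + λ k - 𝔼_P k + D`. Over `0`
  -- they are nonnegative because `D` bounds the primal value.
  let A : Set (B Ω × ℝ) := {x | ∃ (k : B Ω) (a b : ℝ), conjIntegral f Q (k + x.1) ≤ a ∧ l k ≤ b ∧
    x.2 = a + b - integral P.1 k + D}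
  obtain ⟨G, hG⟩ := exists_linear_le_of_convex (A := A)
    (by
      rintro ⟨u, r⟩ ⟨k, a, b, h1, h2, h3⟩ ⟨u', r'⟩ ⟨k', a', b', h1', h2', h3'⟩ α β hα hβ hαβ
      refine ⟨α • k + β • k', α * a + β * a', α * b + β * b', ?_,
        hconv.combo_le hα hβ hαβ h2 h2', ?_⟩
      · have := conjIntegral_combo_le hf hα hβ hαβ h1 h1'
        convert this using 2
        simp only [Prod.fst_add, Prod.smul_fst, smul_add]
        abel
      · dsimp only at h3 h3'
        simp only [Prod.snd_add, Prod.smul_snd, smul_eq_mul, integral_add, integral_smul, h3, h3']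
        linear_combination D * hαβ)
    (by
      rintro r ⟨k, a, b, h1, h2, rfl⟩
      rw [add_zero] at h1
      have h3 : ((integral P.1 k - a - b : ℝ) : EReal) ≤ D :=
        (EReal.sub_le_sub (EReal.sub_le_sub le_rfl h1) h2).trans
          ((le_iSup (fun h : B Ω => (integral P.1 h : EReal) - conjIntegral f Q h - l h) k).trans hD)
      rw [EReal.coe_le_coe_iff] at h3
      linarith)
    (by
      intro u
      -- Every `u` is reached: shift `h₀` by a constant that makes `Φ` finite at `h₀ + u`; `λ` does
      -- not change.
      obtain ⟨c, hc⟩ := exists_const_conjIntegral_le hf Q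
      obtain ⟨b, hb⟩ := hc (h₀ + u)
      exact ⟨_, h₀ + B.const Ω b, c, b₀, by rwa [add_right_comm] at hb,
        (hshift h₀ b).ge.trans h₀l, rfl⟩)
  refine ⟨G, fun h k a b h1 h2 => ?_⟩
  -- The perturbation `u = h - k` lets the arguments of `Φ` and `λ` vary independently.
  have := hG (h - k) (a + b - integral P.1 k + D) ⟨k, a, b, by simpa using h1, h2, rfl⟩
  rw [map_sub] at this
  linarith

/-- Attainment in the dual problem. -/
theorem exists_conjReg_add_extFDiv_le (hf : IsDivergenceFunction f) (hconv : EConvex l)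
    (hshift : ShiftInvariant l) (P : FinAddProb Ω) (hD : regFDiv f l P Q ≠ ⊤) :
    ∃ P' : FinAddProb Ω, AbsCont P'.1 Q ∧
      conjReg l (P.1 - P'.1) + extFDiv f P' Q ≤ regFDiv f l P Q := by
  by_cases hl : ∀ h, l h = ⊤
  · refine ⟨.ofMeasure Q, absCont_ofMeasure Q, ?_⟩
    have : conjReg l (P.1 - (FinAddProb.ofMeasure Q).1) = ⊥ := by simp [conjReg, hl]
    rw [this, EReal.bot_add]
    exact bot_le
  push Not at hl
  obtain ⟨h₀, h₀l⟩ := hl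
  set b₀ := (l h₀).toReal
  replace h₀l : l h₀ ≤ b₀ := EReal.le_coe_toReal h₀l
  obtain ⟨c, hc⟩ := exists_const_conjIntegral_le hf Q
  have hbot : regFDiv f l P Q ≠ ⊥ := by
    obtain ⟨b, hb⟩ := hc h₀
    refine ne_bot_of_le_ne_bot ?_ ((EReal.sub_le_sub (EReal.sub_le_sub le_rfl hb)
      ((hshift h₀ b).ge.trans h₀l)).trans
      (le_iSup (fun h : B Ω => (integral P.1 h : EReal) - conjIntegral f Q h - l h) _))
    rw [← EReal.coe_sub, ← EReal.coe_sub]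
    exact EReal.coe_ne_bot _
  set D := (regFDiv f l P Q).toReal
  have hD' : regFDiv f l P Q = D := (EReal.coe_toReal hD hbot).symm
  obtain ⟨ν, hν⟩ := exists_linear_add_le hf hconv hshift P h₀l hD'.le
  obtain ⟨s, hs⟩ := hc 0
  rw [zero_add] at hs
  have hpos : ∀ h : B Ω, (∀ ω, 0 ≤ h.1 ω) → 0 ≤ ν h := fun h hh => by
    rw [← neg_nonpos]
    refine nonpos_of_forall_mul_le
      (C := D + c - (integral P.1 h₀ - ν h₀ - b₀) - ν (B.const Ω s)) fun t ht => ?_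
    -- Moving down along `-h` keeps `Φ ≤ c` for every `t ≥ 0`, so `t * (-ν h)` stays bounded.
    have h1 : conjIntegral f Q (B.const Ω s - t • h) ≤ c :=
      (conjIntegral_mono hf (ae_of_all _ fun ω => by
        simpa using mul_nonneg ht (hh ω))).trans hs
    have h2 := hν _ _ _ _ h1 h₀l
    rw [map_sub, map_smul, smul_eq_mul] at h2
    linarith
  have hnull : ∀ E hE, Q E = 0 → ν (B.ind E hE) = 0 := fun E hE hQ => by
    refine le_antisymm ?_ (hpos _ fun _ => Set.indicator_nonneg (fun _ _ => zero_le_one) _)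
    refine nonpos_of_forall_mul_le
      (C := D + c - (integral P.1 h₀ - ν h₀ - b₀) - ν (B.const Ω s)) fun t _ => ?_
    -- Adding a multiple of the indicator of a `Q`-null set leaves the bound on `Φ` intact, so `t *
    -- ν (1_E)` stays bounded.
    have h1 : conjIntegral f Q (B.const Ω s + t • B.ind E hE) ≤ c := by
      refine (conjIntegral_mono hf ?_).trans hs
      filter_upwards [measure_eq_zero_iff_ae_notMem.1 hQ] with ω hω
      simp [B.ind, hω]
    have h2 := hν _ _ _ _ h1 h₀l
    rw [map_add, map_smul, smul_eq_mul] at h2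
    linarith
  -- Shifting `h₀` by any real `t` keeps the bound `b₀`; since both signs of `t` occur, the slope `1
  -- - ν 1` vanishes.
  have hline : ∀ t : ℝ, t * (1 - ν (B.const Ω 1)) ≤
      D + c - (integral P.1 h₀ - ν h₀ - b₀) - ν (B.const Ω s) := fun t => by
    have h2 := hν _ _ _ _ hs ((hshift h₀ t).ge.trans h₀l)
    rw [integral_add, integral_const, map_add, ← smul_const_one t, map_smul, smul_eq_mul] at h2
    linarith
  have hone : ν (B.const Ω 1) = 1 := by
    have h1 := nonpos_of_forall_mul_le fun t _ => hline t
    have h2 := nonpos_of_forall_mul_le (x := ν (B.const Ω 1) - 1) fun t _ =>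
      (show t * (ν (B.const Ω 1) - 1) = -t * (1 - ν (B.const Ω 1)) by ring).trans_le (hline (-t))
    linarith
  refine ⟨.ofLinear ν hpos hone, fun E hE hQ => by
    rw [FinAddProb.ofLinear_apply hE, hnull E hE hQ], ?_⟩
  rw [extFDiv_eq_iSup hf, hD']
  -- Near-maximizers `k` and `h` of the two suprema are chosen independently, which is the form of
  -- `hν`.
  refine EReal.add_le_of_forall_lt fun x hx y hy => ?_
  obtain ⟨k, hk⟩ := lt_iSup_iff.1 hx
  obtain ⟨h, hh⟩ := lt_iSup_iff.1 hy
  refine (add_le_add hk.le hh.le).trans ?_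
  rw [integral_sub_left, integral_ofLinear, integral_ofLinear]
  by_cases hΦ : conjIntegral f Q h = ⊤
  · simp [hΦ]
  by_cases hlt : l k = ⊤
  · simp [hlt]
  have h2 := hν h k _ _ (EReal.le_coe_toReal hΦ) (EReal.le_coe_toReal hlt)
  have hΦb := conjIntegral_ne_bot (Q := Q) hf h
  -- If `λ k = -∞`, a shift of `k` with `Φ` finite would make the primal value `⊤`.
  have hlb : l k ≠ ⊥ := fun hlb => by
    obtain ⟨b, hb⟩ := hc k
    refine hD (top_le_iff.1 (le_trans ?_
      (le_iSup (fun h : B Ω => (integral P.1 h : EReal) - conjIntegral f Q h - l h)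
        (k + B.const Ω b))))
    rw [← hshift, hlb]
    lift conjIntegral f Q (k + B.const Ω b) to ℝ using
      ⟨ne_top_of_le_ne_top (EReal.coe_ne_top _) hb, conjIntegral_ne_bot hf _⟩ with a
    rw [← EReal.coe_sub, EReal.coe_sub_bot]
  lift conjIntegral f Q h to ℝ using ⟨hΦ, hΦb⟩ with a
  lift l k to ℝ using ⟨hlt, hlb⟩ with b
  rw [← EReal.coe_sub, ← EReal.coe_sub, ← EReal.coe_add, EReal.coe_le_coe_iff]
  simp only [EReal.toReal_coe] at h2
  linarith

end Duality

end FDiv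

end

theorem theorem1 {Ω : Type*} [MeasurableSpace Ω] (f : ℝ → EReal)
    (hf : FDiv.IsDivergenceFunction f) (l : FDiv.B Ω → EReal) (hconv : FDiv.EConvex l)
    (hshift : FDiv.ShiftInvariant l) (P : FDiv.FinAddProb Ω)
    (Q : MeasureTheory.Measure Ω) [MeasureTheory.IsProbabilityMeasure Q] :
    FDiv.regFDiv f l P Q =
        (⨅ P' : FDiv.FinAddProb Ω, FDiv.conjReg l (P.1 - P'.1) + FDiv.extFDiv f P' Q) ∧
    FDiv.regFDiv f l P Q =
        (⨅ P' : {P' : FDiv.FinAddProb Ω // FDiv.AbsCont P'.1 Q},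
          FDiv.conjReg l (P.1 - P'.1.1) + FDiv.extFDiv f P'.1 Q) := by
  have hle := FDiv.regFDiv_le_conjReg_add_extFDiv (l := l) (Q := Q) hf P
  have hex : ∃ P' : FDiv.FinAddProb Ω, FDiv.AbsCont P'.1 Q ∧
      FDiv.conjReg l (P.1 - P'.1) + FDiv.extFDiv f P' Q ≤ FDiv.regFDiv f l P Q := by
    by_cases hD : FDiv.regFDiv f l P Q = ⊤
    · exact ⟨.ofMeasure Q, FDiv.absCont_ofMeasure Q, by
        rw [hD]
        exact le_top⟩
    · exact FDiv.exists_conjReg_add_extFDiv_le hf hconv hshift P hD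
  obtain ⟨P', hP', h⟩ := hex
  refine ⟨le_antisymm (le_iInf hle) (iInf_le_of_le P' h),
    le_antisymm (le_iInf fun R => hle R.1) (iInf_le_of_le ⟨P', hP'⟩ h)⟩
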